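/- For $p,q\ge 0$ let $\mathbb R^{p,q+1}$ be $\mathbb R^{p+q+1}$ with the standard symmetric bilinear form $\mathbf b$ of signature $(p,q+1)$, let $\mathbb H^{p,q}=\{[x]\in\mathbb P(\mathbb R^{p,q+1}) : \mathbf b(x,x)<0\}$ be the pseudo-hyperbolic space, with the volume of the pseudo-Riemannian metric induced by $\mathbf b$ on $\{x : \mathbf b(x,x)=-1\}$, and let $\partial\mathbb H^{p,q}=\{[x] : \mathbf b(x,x)=0\}$. A positive lift of a set $\Lambda\subset\mathbb P(\mathbb R^{p,q+1})$ is a choice, for every $\xi\in\Lambda$, of a non-zero vector $s(\xi)\in\xi$ such that $0$ is not in the convex hull of $s(\Lambda)$ and $\mathbf b(s(\xi),s(\eta))\le 0$ for all $\xi,\eta\in\Lambda$; then $\mathrm{Conv}(s)$ is the interior of the projectivization of the convex hull of $s(\Lambda)$. A simplex of $\mathbb H^{p,q}$ is a set $\Lambda$ of $p+q+1$ points of $\mathbb P(\mathbb R^{p,q+1})$, spanning $\mathbb R^{p,q+1}$, that admits a positive lift and each point of which is extremal in a convex hull of $\Lambda$. It is ideal if $\Lambda\subset\partial\mathbb H^{p,q}$.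 It has infinite volume if $\mathrm{Conv}(s)$ has infinite volume for every positive lift $s$ of $\Lambda$ (these volumes are all equal). Let $p,q\ge 1$ be integers. (1) There is a non-ideal simplex $\Lambda$ of infinite volume in $\mathbb H^{p,q}$. (2) If $p\ge 3$, there is moreover an ideal simplex $\Lambda$ of infinite volume in $\mathbb H^{p,q}$. More precisely, $\mathbb H^{1,0}$ has exactly one ideal simplex $\Lambda_0\subset\mathbb P(\mathbb R^{1,1})$, and in both cases $\Lambda$ can be taken to be an orthogonal sum of $\Lambda_0$ and of a simplex $\Lambda_1\subset\mathbb P(\mathbb R^{p-1,q})$ of $\mathbb H^{p-1,q-1}$, where $\Lambda_1$ is ideal in case (2): that is, $\Lambda=\Lambda_0\cup\Lambda_1$ for some isometric identification $\mathbb R^{p,q+1}=\mathbb R^{1,1}\oplus\mathbb R^{p-1,q}$ with the orthogonal sum. -/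

import Mathlib

open scoped LinearAlgebra.Projectivization

namespace PseudoHyperbolic

noncomputable section

/-- The underlying vector space of `ℝ^{p,r}`: the coordinates `Sum.inl i` are the `p` positive
directions, the coordinates `Sum.inr j` are the `r` negative ones. -/
abbrev PVec (p r : ℕ) : Type := Fin p ⊕ Fin r → ℝ

/-- The standard symmetric bilinear form of signature `(p, r)`. -/
def form {p r : ℕ} (x y : PVec p r) : ℝ :=
  ∑ i, x (Sum.inl i) * y (Sum.inl i) - ∑ j, x (Sum.inr j) * y (Sum.inr j)

/-- The usual (quotient) topology of the real projective space `P(ℝ^{p,r})`. -/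
instance {p r : ℕ} : TopologicalSpace (ℙ ℝ (PVec p r)) :=
  TopologicalSpace.coinduced (Projectivization.mk' ℝ) inferInstance

/-- The pseudo-hyperbolic space `H^{p,q}`, an open subset of `P(ℝ^{p,q+1})`. -/
def hyp (p q : ℕ) : Set (ℙ ℝ (PVec p (q + 1))) :=
  {ξ | ∃ x, ∃ hx : x ≠ 0, Projectivization.mk ℝ x hx = ξ ∧ form x x < 0}

/-- The projective boundary `∂H^{p,q}`: the isotropic lines of `ℝ^{p,q+1}`. -/
def boundary (p q : ℕ) : Set (ℙ ℝ (PVec p (q + 1))) :=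
  {ξ | ∃ x, ∃ hx : x ≠ 0, Projectivization.mk ℝ x hx = ξ ∧ form x x = 0}

/-! ### The pseudo-Riemannian volume -/

/-- The affine chart `y ↦ [y : 1]` (last negative coordinate equal to `1`), at the level of
vectors. -/
def affinePoint {p q : ℕ} (y : PVec p q) : PVec p (q + 1) :=
  Sum.elim (fun i => y (Sum.inl i)) (Fin.snoc (α := fun _ => ℝ) (fun j => y (Sum.inr j)) 1)

theorem affinePoint_ne_zero {p q : ℕ} (y : PVec p q) : affinePoint y ≠ 0 := by
  intro h
  have := congrFun h (Sum.inr (Fin.last q))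
  simp [affinePoint] at this

/-- The affine chart `y ↦ [y : 1]` of the projective space. -/
def chart {p q : ℕ} (y : PVec p q) : ℙ ℝ (PVec p (q + 1)) :=
  Projectivization.mk ℝ (affinePoint y) (affinePoint_ne_zero y)

/-- The lift of the affine chart to the double cover `{x | form x x = -1}` of `H^{p,q}`; it is
meaningful (and smooth) at the `y` with `chart y ∈ hyp p q`. -/
def hypLift {p q : ℕ} (y : PVec p q) : PVec p (q + 1) :=
  (Real.sqrt (-form (affinePoint y) (affinePoint y)))⁻¹ • affinePoint y

/-- The matrix, in the coordinates `y` of the affine chart, of the pseudo-Riemannian metric of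
`H^{p,q}`. This metric is the restriction of `form` to the tangent spaces of the hypersurface
`{x | form x x = -1}`, pulled back here by the local parametrization `hypLift`. -/
def metricMatrix {p q : ℕ} (y : PVec p q) : Matrix (Fin p ⊕ Fin q) (Fin p ⊕ Fin q) ℝ :=
  Matrix.of fun i j =>
    form (fderiv ℝ (hypLift (p := p) (q := q)) y (Pi.single i 1))
      (fderiv ℝ (hypLift (p := p) (q := q)) y (Pi.single j 1))

/-- The pseudo-Riemannian volume in `H^{p,q}` of (the part in `H^{p,q}` of) a set `A` of points
of the projective space: the integral of `|det g|^{1/2}` in the affine chart. One affine chart is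
enough, since its complement is a projective hyperplane, which has volume zero. -/
def hypVolume {p q : ℕ} (A : Set (ℙ ℝ (PVec p (q + 1)))) : ENNReal :=
  ∫⁻ y in {y : PVec p q | chart y ∈ A ∩ hyp p q},
    ENNReal.ofReal (Real.sqrt |(metricMatrix y).det|)

/-! ### Positive lifts, convex hulls, simplices -/

/-- A lift of `Λ`: a choice of a non-zero vector on each line `ξ ∈ Λ`. -/
def IsLift {p r : ℕ} (Λ : Set (ℙ ℝ (PVec p r))) (s : Λ → PVec p r) : Prop :=
  ∀ ξ : Λ, ∃ h : s ξ ≠ 0, Projectivization.mk ℝ (s ξ) h = ξ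

/-- A positive lift. -/
def IsPositiveLift {p r : ℕ} (Λ : Set (ℙ ℝ (PVec p r))) (s : Λ → PVec p r) : Prop :=
  IsLift Λ s ∧ (0 : PVec p r) ∉ convexHull ℝ (Set.range s) ∧ ∀ ξ η, form (s ξ) (s η) ≤ 0

/-- The projectivization of the convex hull of a set of vectors. -/
def projHull {p r : ℕ} (S : Set (PVec p r)) : Set (ℙ ℝ (PVec p r)) :=
  {ξ | ∃ x ∈ convexHull ℝ S, ∃ hx : x ≠ 0, Projectivization.mk ℝ x hx = ξ}

/-- The convex hull `Conv(s)` attached to a positive lift `s` of `Λ`: the interior of the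
projectivization of the convex hull of the vectors `s ξ`. -/
def conv {p r : ℕ} {Λ : Set (ℙ ℝ (PVec p r))} (s : Λ → PVec p r) : Set (ℙ ℝ (PVec p r)) :=
  interior (projHull (Set.range s))

/-- A polytope: a finite set of points having a positive lift, each point being extremal in the
corresponding convex hull, i.e. not a convex combination of the other points. -/
def IsPolytope {p q : ℕ} (Λ : Set (ℙ ℝ (PVec p (q + 1)))) : Prop :=
  Λ.Finite ∧ ∃ s : Λ → PVec p (q + 1), IsPositiveLift Λ s ∧
    ∀ ξ : Λ, (ξ : ℙ ℝ (PVec p (q + 1))) ∉ projHull (s '' {η | η ≠ ξ})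

/-- A simplex of `H^{p,q}`: a polytope with `p + q + 1` vertices spanning `ℝ^{p,q+1}`. -/
def IsSimplex {p q : ℕ} (Λ : Set (ℙ ℝ (PVec p (q + 1)))) : Prop :=
  IsPolytope Λ ∧ Λ.ncard = p + q + 1 ∧ ⨆ ξ ∈ Λ, ξ.submodule = ⊤

/-- `Λ` is ideal if it is contained in the projective boundary `∂H^{p,q}`. -/
def IsIdeal {p q : ℕ} (Λ : Set (ℙ ℝ (PVec p (q + 1)))) : Prop :=
  Λ ⊆ boundary p q

/-- `Λ` has volume `v`: it has convex hulls, and all of them have volume `v`. -/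
def HasVolume {p q : ℕ} (Λ : Set (ℙ ℝ (PVec p (q + 1)))) (v : ENNReal) : Prop :=
  (∃ s, IsPositiveLift Λ s) ∧ ∀ s, IsPositiveLift Λ s → hypVolume (conv s) = v

/-! ### Orthogonal sums -/

/-- The set of lines obtained from a set of lines by an injective linear map. -/
def mapLines {p r p' r' : ℕ} (f : PVec p r →ₗ[ℝ] PVec p' r') (Λ : Set (ℙ ℝ (PVec p r))) :
    Set (ℙ ℝ (PVec p' r')) :=
  {ξ | ∃ η ∈ Λ, ξ.submodule = η.submodule.map f}

/-- `Λ` is the orthogonal sum of `Λ₀` and `Λ₁`: for some isometric identification of the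
orthogonal sum `ℝ^{p₀,r₀} ⊕ ℝ^{p₁,r₁}` with `ℝ^{p,r}`, the set `Λ` is the union of `Λ₀` and `Λ₁`
seen as sets of lines of the two summands. -/
def IsOrthogonalSum {p₀ r₀ p₁ r₁ p r : ℕ} (Λ₀ : Set (ℙ ℝ (PVec p₀ r₀)))
    (Λ₁ : Set (ℙ ℝ (PVec p₁ r₁))) (Λ : Set (ℙ ℝ (PVec p r))) : Prop :=
  ∃ e : (PVec p₀ r₀ × PVec p₁ r₁) ≃ₗ[ℝ] PVec p r,
    (∀ u v, form (e u) (e v) = form u.1 v.1 + form u.2 v.2) ∧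
    Λ = mapLines (e.toLinearMap ∘ₗ LinearMap.inl ℝ _ _) Λ₀ ∪
      mapLines (e.toLinearMap ∘ₗ LinearMap.inr ℝ _ _) Λ₁

end

end PseudoHyperbolic

open Module
open scoped LinearAlgebra.Projectivization

namespace PseudoHyperbolic

noncomputable section

/-! The two isotropic lines of the plane `ℝ^{1,1}` are eigenlines of its Lorentz boosts. If a
simplex is the orthogonal sum of these two lines and of `Λ₁`, a boost extended by the identity
multiplies one vertex vector by 2, another by 1/2, and fixes the others. It therefore preserves the
open cone over the vertices, hence the convex hull, and generates an infinite group of isometries of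
it. A piece of positive volume has infinitely many disjoint translates, so the hull has infinite
volume.

To make this computable, the volume is read in the affine chart where the last negative coordinate
is 1. With N = -`form` at the affine point, the density is N^(-(p+q+1)/2) (`abs_det_metricMatrix`).
As q ≥ 1, the boost can use a negative coordinate other than the last one: in the chart it is then
linear, of determinant ±1, and keeps N unchanged (`affinePoint_boost`). Translated slabs have equal
Lebesgue measure, and a bound on N bounds the density below (`hypVolume_interior_projHull_eq_top`).
A positive lift only rescales the eigenvectors, so every lift is covered
(`hypVolume_conv_sumBasis`).

It remains to exhibit `Λ₁`: bases with nonpositive products, one with a non-isotropic vector, and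
one that is entirely isotropic when p - 1 ≥ 2 (`exists_nonIdeal_basis`, `exists_ideal_basis`). -/

/-- `form` as a bilinear map. -/
def formBilin (p r : ℕ) : PVec p r →ₗ[ℝ] PVec p r →ₗ[ℝ] ℝ :=
  LinearMap.mk₂ ℝ form
    (fun x y z => by simp only [form, Pi.add_apply, add_mul, Finset.sum_add_distrib]; ring)
    (fun c x y => by
      simp only [form, Pi.smul_apply, smul_eq_mul, mul_assoc, ← Finset.mul_sum]; ring)
    (fun x y z => by simp only [form, Pi.add_apply, mul_add, Finset.sum_add_distrib]; ring)
    (fun c x y => by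
      simp only [form, Pi.smul_apply, smul_eq_mul, mul_left_comm _ c, ← Finset.mul_sum]; ring)

theorem formBilin_apply {p r : ℕ} (x y : PVec p r) : formBilin p r x y = form x y := rfl

/-! ### Bilinear algebra of the form -/

section Form

variable {p r : ℕ}

theorem form_comm (x y : PVec p r) : form x y = form y x := by
  simp only [form, mul_comm]

theorem form_add_left (x y z : PVec p r) : form (x + y) z = form x z + form y z :=
  LinearMap.map_add₂ (formBilin p r) x y z

theorem form_add_right (x y z : PVec p r) : form x (y + z) = form x y + form x z :=
  map_add (formBilin p r x) y z

theorem form_smul_left (c : ℝ) (x y : PVec p r) : form (c • x) y = c * form x y :=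
  LinearMap.map_smul₂ (formBilin p r) c x y

theorem form_smul_right (c : ℝ) (x y : PVec p r) : form x (c • y) = c * form x y :=
  map_smul (formBilin p r x) c y

theorem form_zero_left (x : PVec p r) : form 0 x = 0 :=
  LinearMap.map_zero₂ (formBilin p r) x

theorem form_zero_right (x : PVec p r) : form x 0 = 0 :=
  map_zero (formBilin p r x)

theorem form_sum_smul {ι : Type*} [Fintype ι] (t : ι → ℝ) (v : ι → PVec p r) :
    form (∑ i, t i • v i) (∑ i, t i • v i) = ∑ i, ∑ j, t i * t j * form (v i) (v j) := by
  simp only [← formBilin_apply, map_sum, LinearMap.sum_apply, map_smul, LinearMap.smul_apply,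
    smul_eq_mul]
  simp only [Finset.mul_sum]
  rw [Finset.sum_comm]
  exact Finset.sum_congr rfl fun i _ => Finset.sum_congr rfl fun j _ => by ring

theorem continuous_form_self : Continuous fun x : PVec p r => form x x := by
  unfold form; fun_prop

end Form

/-! ### Simplices spanned by bases -/

section Simplex

variable {p q : ℕ} {ι : Type*}

/-- The set of the lines spanned by the vectors of a basis. -/
def basisLines {p r : ℕ} (b : Basis ι ℝ (PVec p r)) : Set (ℙ ℝ (PVec p r)) :=
  Set.range fun i => Projectivization.mk ℝ (b i) (b.ne_zero i)

theorem mk_basis_injective {p r : ℕ} (b : Basis ι ℝ (PVec p r)) :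
    Function.Injective fun i => Projectivization.mk ℝ (b i) (b.ne_zero i) := by
  intro i j h
  obtain ⟨a, ha⟩ := (Projectivization.mk_eq_mk_iff' ℝ _ _ _ _).1 h
  by_contra hij
  have h1 := congrArg (fun x => b.repr x i) ha
  simp [Ne.symm hij] at h1

/-- The hull of a basis lies in the affine hyperplane where the coordinates sum to 1, which misses
0. -/
theorem exists_isPositiveLift_basisLines {p r : ℕ} [Fintype ι] (b : Basis ι ℝ (PVec p r))
    (hb : ∀ i j, form (b i) (b j) ≤ 0) :
    ∃ s : basisLines b → PVec p r, IsPositiveLift (basisLines b) s ∧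
      ∀ i, s ⟨_, Set.mem_range_self i⟩ = b i := by
  have key : ∀ i, b ((Set.mem_range_self (f := fun i => Projectivization.mk ℝ (b i) (b.ne_zero i))
      i).choose) = b i := fun i => by
    have h := (Set.mem_range_self (f := fun i => Projectivization.mk ℝ (b i) (b.ne_zero i))
      i).choose_spec
    rw [mk_basis_injective b h]
  refine ⟨fun ξ => b ξ.2.choose, ⟨fun ξ => ⟨b.ne_zero _, ξ.2.choose_spec⟩, ?_, fun _ _ => hb _ _⟩,
    key⟩
  intro h0
  have hconv : Convex ℝ {x : PVec p r | ∑ i, b.repr x i = 1} := by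
    intro x hx y hy s t _ _ hst
    simp only [Set.mem_ofPred_eq, map_add, map_smul, Finsupp.add_apply, Finsupp.smul_apply,
      Finset.sum_add_distrib, ← Finset.smul_sum] at *
    simp [hx, hy, hst]
  have hsub : convexHull ℝ (Set.range fun ξ : basisLines b => b ξ.2.choose) ⊆
      {x : PVec p r | ∑ i, b.repr x i = 1} := by
    refine convexHull_min ?_ hconv
    rintro _ ⟨ξ, rfl⟩
    simp
  simpa using hsub h0

/-- Each vertex is extremal because the hull of the others lies in the hyperplane where its
coordinate vanishes. -/
theorem isSimplex_basisLines [Fintype ι] (b : Basis ι ℝ (PVec p (q + 1)))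
    (hb : ∀ i j, form (b i) (b j) ≤ 0) : IsSimplex (basisLines b) := by
  obtain ⟨s, hs, hsb⟩ := exists_isPositiveLift_basisLines b hb
  refine ⟨⟨Set.finite_range _, s, hs, ?_⟩, ?_, ?_⟩
  · rintro ⟨_, i, rfl⟩ ⟨x, hx, hx0, hxi⟩
    obtain ⟨a, ha⟩ := (Projectivization.mk_eq_mk_iff' ℝ _ _ _ _).1 hxi
    have hconv : Convex ℝ {x : PVec p (q + 1) | b.repr x i = 0} := by
      intro x hx y hy s t _ _ hst
      simp only [Set.mem_ofPred_eq, map_add, map_smul, Finsupp.add_apply, Finsupp.smul_apply] at *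
      simp [hx, hy]
    have hsub := convexHull_min (t := {x : PVec p (q + 1) | b.repr x i = 0}) ?_ hconv hx
    · have : a = 0 := by
        rw [Set.mem_ofPred_eq, ← ha] at hsub
        simpa using hsub
      exact hx0 (by rw [← ha, this, zero_smul])
    · rintro _ ⟨⟨_, j, rfl⟩, hj, rfl⟩
      have hij : j ≠ i := by
        rintro rfl
        exact hj rfl
      rw [hsb j]
      simp [hij]
  · rw [basisLines, Set.ncard_range_of_injective (mk_basis_injective b), Nat.card_eq_fintype_card,
      ← finrank_eq_card_basis b, finrank_fintype_fun_eq_card]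
    simp [add_assoc]
  · rw [eq_top_iff, ← b.span_eq, Submodule.span_le]
    rintro _ ⟨i, rfl⟩
    have hi : Projectivization.mk ℝ (b i) (b.ne_zero i) ∈ basisLines b := Set.mem_range_self i
    refine (le_iSup₂_of_le (f := fun (ξ : ℙ ℝ (PVec p (q + 1))) (_ : ξ ∈ basisLines b) =>
      ξ.submodule) _ hi le_rfl) ?_
    exact Submodule.mem_span_singleton_self _

theorem mk_mem_boundary_iff {x : PVec p (q + 1)} (hx : x ≠ 0) :
    Projectivization.mk ℝ x hx ∈ boundary p q ↔ form x x = 0 := by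
  refine ⟨?_, fun h => ⟨x, hx, rfl, h⟩⟩
  rintro ⟨y, hy, hxy, h⟩
  obtain ⟨a, ha⟩ := (Projectivization.mk_eq_mk_iff' ℝ _ _ _ _).1 hxy
  rw [← ha, form_smul_left, form_smul_right] at h
  have ha0 : a ≠ 0 := by
    rintro rfl
    exact hy (by rw [← ha, zero_smul])
  simpa [ha0] using h

theorem isIdeal_basisLines_iff (b : Basis ι ℝ (PVec p (q + 1))) :
    IsIdeal (basisLines b) ↔ ∀ i, form (b i) (b i) = 0 := by
  simp [IsIdeal, basisLines, Set.range_subset_iff, mk_mem_boundary_iff]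

end Simplex

/-! ### The volume density -/

section Density

variable {p q : ℕ}

/-- The linear part of the affine map `affinePoint`. -/
def affineDir (p q : ℕ) : PVec p q →L[ℝ] PVec p (q + 1) :=
  LinearMap.toContinuousLinearMap
    { toFun := fun w => Sum.elim (fun i => w (Sum.inl i))
        (Fin.snoc (α := fun _ => ℝ) (fun j => w (Sum.inr j)) 0)
      map_add' := fun x y => by
        ext (i | j)
        · simp
        · refine Fin.lastCases ?_ (fun j => ?_) j <;> simp
      map_smul' := fun c x => by
        ext (i | j)
        · simp
        · refine Fin.lastCases ?_ (fun j => ?_) j <;> simp }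

theorem affineDir_apply (w : PVec p q) : affineDir p q w = Sum.elim (fun i => w (Sum.inl i))
    (Fin.snoc (α := fun _ => ℝ) (fun j => w (Sum.inr j)) 0) := rfl

theorem affinePoint_eq (y : PVec p q) : affinePoint y = affineDir p q y + affinePoint 0 := by
  ext (i | j)
  · simp [affineDir_apply, affinePoint]
  · refine Fin.lastCases ?_ (fun j => ?_) j <;> simp [affineDir_apply, affinePoint]

theorem continuous_affinePoint : Continuous (affinePoint (p := p) (q := q)) := by
  rw [funext affinePoint_eq]
  fun_prop

theorem form_affinePoint (y : PVec p q) : form (affinePoint y) (affinePoint y) = form y y - 1 := by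
  simp [form, affinePoint, Fin.sum_univ_castSucc]
  ring

theorem form_affinePoint_affineDir (y w : PVec p q) :
    form (affinePoint y) (affineDir p q w) = form y w := by
  simp [form, affinePoint, affineDir_apply, Fin.sum_univ_castSucc]

theorem form_affineDir (v w : PVec p q) : form (affineDir p q v) (affineDir p q w) = form v w := by
  simp [form, affineDir_apply, Fin.sum_univ_castSucc]

theorem fderiv_hypLift {y : PVec p q} (hy : form (affinePoint y) (affinePoint y) < 0)
    (w : PVec p q) :
    fderiv ℝ (hypLift (p := p) (q := q)) y w =
      (Real.sqrt (-form (affinePoint y) (affinePoint y)))⁻¹ • affineDir p q w +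
      (form y w / Real.sqrt (-form (affinePoint y) (affinePoint y)) ^ 3) • affinePoint y := by
  have ha : HasFDerivAt (affinePoint (p := p) (q := q)) (affineDir p q) y := by
    rw [funext affinePoint_eq]
    exact (affineDir p q).hasFDerivAt.add_const _
  obtain ⟨N', hN, hN'⟩ : ∃ N' : PVec p q →L[ℝ] ℝ,
      HasFDerivAt (fun y : PVec p q => -form (affinePoint y) (affinePoint y)) N' y ∧
        ∀ w, N' w = -(2 * form y w) := by
    refine ⟨_, ((formBilin p (q + 1)).toContinuousBilinearMap.hasFDerivAt_of_bilinear ha ha).neg,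
      fun w => ?_⟩
    change -(form (affinePoint y) (affineDir p q w) + form (affineDir p q w) (affinePoint y)) = _
    rw [form_comm (affineDir p q w), form_affinePoint_affineDir]
    ring
  have hpos : 0 < -form (affinePoint y) (affinePoint y) := by linarith
  have hk := Real.sqrt_pos.2 hpos
  have hr := ((hasDerivAt_inv hk.ne').comp_hasFDerivAt y (hN.sqrt hpos.ne')).smul ha
  have hL : HasFDerivAt (hypLift (p := p) (q := q)) _ y := hr
  rw [hL.fderiv]
  simp only [add_apply, smul_apply,
    ContinuousLinearMap.smulRight_apply, hN', smul_eq_mul, Function.comp_apply]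
  congr 2
  field_simp

/-- With N = -`form` at the affine point, the two cross terms contribute 2/N² and the radial term
-1/N² to the rank-one part, which leaves 1/N². -/
theorem metricMatrix_eq {y : PVec p q} (hy : form (affinePoint y) (affinePoint y) < 0) :
    metricMatrix y = (-form (affinePoint y) (affinePoint y))⁻¹ •
      (Matrix.of (fun i j => form (Pi.single i 1 : PVec p q) (Pi.single j 1)) +
        (-form (affinePoint y) (affinePoint y))⁻¹ •
          Matrix.vecMulVec (fun i => form y (Pi.single i 1)) (fun i => form y (Pi.single i 1))) := by
  have hpos : 0 < -form (affinePoint y) (affinePoint y) := by linarith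
  have hk := Real.sqrt_pos.2 hpos
  have hk2 := Real.sq_sqrt hpos.le
  ext i j
  simp only [metricMatrix, Matrix.of_apply, fderiv_hypLift hy, form_add_left, form_add_right,
    form_smul_left, form_smul_right, form_affineDir, form_affinePoint_affineDir,
    form_comm (affineDir p q _) (affinePoint y), Matrix.smul_apply, Matrix.add_apply,
    Matrix.vecMulVec_apply, smul_eq_mul]
  set k := Real.sqrt (-form (affinePoint y) (affinePoint y))
  have h : form (affinePoint y) (affinePoint y) = -k ^ 2 := by linarith
  rw [h, neg_neg]
  field_simp
  ring

/-- The bracket in `metricMatrix_eq` is a sign matrix times a rank-one perturbation of the identity,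
whose determinant is 1 + (1 - N)/N = 1/N; the scalar factor gives the other p + q powers. -/
theorem abs_det_metricMatrix {y : PVec p q} (hy : form (affinePoint y) (affinePoint y) < 0) :
    |(metricMatrix y).det| = ((-form (affinePoint y) (affinePoint y)) ^ (p + q + 1))⁻¹ := by
  have hpos : 0 < -form (affinePoint y) (affinePoint y) := by linarith
  let ε : Fin p ⊕ Fin q → ℝ := Sum.elim 1 (-1)
  have hJ : Matrix.of (fun i j => form (Pi.single i 1 : PVec p q) (Pi.single j 1)) =
      Matrix.diagonal ε := by
    ext (i | i) (j | j) <;> simp [form, Matrix.diagonal_apply, Pi.single_apply, ε, eq_comm]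
    split_ifs <;> simp
  have hform : ∀ i, form y (Pi.single i 1) = ε i * y i := by
    rintro (i | i) <;> simp [form, Pi.single_apply, ε]
  have hyy : form y y = ∑ i, ε i * (y i * y i) := by
    simp [form, ε, Fintype.sum_sum_type, sub_eq_add_neg]
  have hfac : Matrix.of (fun i j => form (Pi.single i 1 : PVec p q) (Pi.single j 1)) +
        (-form (affinePoint y) (affinePoint y))⁻¹ •
          Matrix.vecMulVec (fun i => form y (Pi.single i 1)) (fun i => form y (Pi.single i 1)) =
      Matrix.diagonal ε * (1 + Matrix.replicateCol Unit y * Matrix.replicateRow Unit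
        (fun i => (-form (affinePoint y) (affinePoint y))⁻¹ * (ε i * y i))) := by
    rw [hJ]
    ext i j
    rw [Matrix.diagonal_mul]
    simp only [Matrix.add_apply, Matrix.smul_apply, Matrix.vecMulVec_apply, Matrix.mul_apply,
      Matrix.replicateCol_apply, Matrix.replicateRow_apply, hform, Matrix.one_apply,
      Matrix.diagonal_apply, Finset.univ_unique, Finset.sum_singleton, smul_eq_mul]
    split_ifs <;> ring
  rw [metricMatrix_eq hy, hfac, Matrix.det_smul, Matrix.det_mul,
    Matrix.det_one_add_replicateCol_mul_replicateRow, Matrix.det_diagonal, abs_mul, abs_mul]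
  have h1 : |∏ i, ε i| = 1 := by
    rw [Finset.abs_prod]
    exact Finset.prod_eq_one fun i _ => by rcases i with i | i <;> simp [ε]
  have h2 : (fun i => (-form (affinePoint y) (affinePoint y))⁻¹ * (ε i * y i)) ⬝ᵥ y =
      (-form (affinePoint y) (affinePoint y))⁻¹ * form y y := by
    rw [hyy, Finset.mul_sum]
    exact Finset.sum_congr rfl fun i _ => by ring
  have h3 : form y y = 1 - -form (affinePoint y) (affinePoint y) := by
    rw [form_affinePoint]; ring
  rw [h1, h2, h3]
  set N := -form (affinePoint y) (affinePoint y)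
  have h4 : 1 + N⁻¹ * (1 - N) = N⁻¹ := by field_simp; ring
  rw [h4, abs_of_pos (by positivity), abs_of_pos (by positivity)]
  simp [pow_succ, mul_comm]

end Density

/-! ### Convex hulls of bases and their volume -/

section Volume

variable {p q : ℕ} {ι : Type*}

theorem continuous_repr {p r : ℕ} (s : Basis ι ℝ (PVec p r)) (i : ι) :
    Continuous fun x => s.repr x i :=
  LinearMap.continuous_of_finiteDimensional (s.coord i)

/-- The lines through the open positive cone form an open set, since their preimage is the union of
two opposite open orthants. The scalar `ε` only allows a representative with all coordinates
negative. -/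
theorem mk_mem_interior_projHull {p r : ℕ} [Fintype ι] [Nonempty ι] (s : Basis ι ℝ (PVec p r))
    {x : PVec p r} (hx : x ≠ 0) {ε : ℝ} (h : ∀ i, 0 < ε * s.repr x i) :
    Projectivization.mk ℝ x hx ∈ interior (projHull (Set.range s)) := by
  have hsub : {ξ | ∃ x, ∃ hx : x ≠ 0, Projectivization.mk ℝ x hx = ξ ∧ ∀ i, 0 < s.repr x i} ⊆
      projHull (Set.range s) := by
    rintro _ ⟨x, hx, rfl, h⟩
    have hT : 0 < ∑ i, s.repr x i := Finset.sum_pos (fun i _ => h i) Finset.univ_nonempty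
    refine ⟨(∑ i, s.repr x i)⁻¹ • x, ?_, smul_ne_zero (inv_ne_zero hT.ne') hx, ?_⟩
    · have hmem := (convex_convexHull ℝ (Set.range s)).sum_mem (t := Finset.univ)
        (w := fun i => (∑ i, s.repr x i)⁻¹ * s.repr x i) (z := s)
        (fun i _ => mul_nonneg (inv_nonneg.2 hT.le) (h i).le)
        (by rw [← Finset.mul_sum, inv_mul_cancel₀ hT.ne'])
        (fun i _ => subset_convexHull ℝ _ (Set.mem_range_self i))
      simpa only [mul_smul, ← Finset.smul_sum, s.sum_repr] using hmem
    · exact (Projectivization.mk_eq_mk_iff' ℝ _ _ _ _).2 ⟨_, rfl⟩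
  refine interior_maximal hsub ?_ ?_
  · rw [isOpen_coinduced]
    have : Projectivization.mk' ℝ ⁻¹' {ξ | ∃ x, ∃ hx : x ≠ 0,
        Projectivization.mk ℝ x hx = ξ ∧ ∀ i, 0 < s.repr x i} =
        {v : {v : PVec p r // v ≠ 0} | ∀ i, 0 < s.repr v i} ∪ {v | ∀ i, s.repr v i < 0} := by
      ext v
      constructor
      · rintro ⟨x, hx, hxv, h⟩
        obtain ⟨a, ha⟩ := (Projectivization.mk_eq_mk_iff' ℝ _ _ _ v.2).1 hxv
        have h' : ∀ i, 0 < a * s.repr v i := fun i => by simpa [← ha] using h i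
        rcases lt_trichotomy a 0 with ha0 | ha0 | ha0
        · exact Or.inr fun i => (pos_iff_pos_of_mul_pos (by simpa using h' i : 0 < -a * -s.repr v i)).1
            (neg_pos.2 ha0) |> neg_pos.1
        · simp [ha0] at h'
        · exact Or.inl fun i => (mul_pos_iff_of_pos_left ha0).1 (h' i)
      · rintro (h | h)
        · exact ⟨v, v.2, rfl, h⟩
        · exact ⟨-v, neg_ne_zero.2 v.2,
            (Projectivization.mk_eq_mk_iff' ℝ _ _ _ _).2 ⟨-1, by simp⟩, by simpa using h⟩
    rw [this]
    refine IsOpen.union ?_ ?_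
    · simp only [Set.ofPred_forall]
      exact isOpen_iInter_of_finite fun i =>
        isOpen_lt continuous_const ((continuous_repr s i).comp continuous_subtype_val)
    · simp only [Set.ofPred_forall]
      exact isOpen_iInter_of_finite fun i =>
        isOpen_lt ((continuous_repr s i).comp continuous_subtype_val) continuous_const
  · have hε : ε ≠ 0 := by
      rintro rfl
      simpa using h (Classical.arbitrary ι)
    exact ⟨ε • x, smul_ne_zero hε hx, (Projectivization.mk_eq_mk_iff' ℝ _ _ _ _).2 ⟨_, rfl⟩,
      by simpa using h⟩

theorem form_self_neg_of_repr_pos {p r : ℕ} [Fintype ι] (s : Basis ι ℝ (PVec p r))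
    (hs : ∀ i j, form (s i) (s j) ≤ 0) {i₀ i₁ : ι} (h01 : form (s i₀) (s i₁) < 0)
    {x : PVec p r} {ε : ℝ} (h : ∀ i, 0 < ε * s.repr x i) : form x x < 0 := by
  have hpos : ∀ i j, 0 < s.repr x i * s.repr x j := fun i j => by
    have h1 := mul_pos (h i) (h j)
    have h2 : 0 < ε ^ 2 * (s.repr x i * s.repr x j) := by linarith
    exact pos_of_mul_pos_right h2 (sq_nonneg ε)
  rw [← s.sum_repr x, form_sum_smul]
  have hle : ∀ i j, s.repr x i * s.repr x j * form (s i) (s j) ≤ 0 := fun i j =>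
    mul_nonpos_of_nonneg_of_nonpos (hpos i j).le (hs i j)
  refine Finset.sum_neg' (fun i _ => Finset.sum_nonpos fun j _ => hle i j)
    ⟨i₀, Finset.mem_univ _, Finset.sum_neg' (fun j _ => hle i₀ j)
    ⟨i₁, Finset.mem_univ _, mul_neg_of_pos_of_neg (hpos i₀ i₁) h01⟩⟩

theorem exists_affinePoint_eq {x : PVec p (q + 1)} (hx : x (Sum.inr (Fin.last q)) ≠ 0) :
    ∃ y : PVec p q, affinePoint y = (x (Sum.inr (Fin.last q)))⁻¹ • x := by
  refine ⟨Sum.elim (fun i => (x (Sum.inr (Fin.last q)))⁻¹ * x (Sum.inl i))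
    (fun j => (x (Sum.inr (Fin.last q)))⁻¹ * x (Sum.inr j.castSucc)), ?_⟩
  ext (i | j)
  · simp [affinePoint]
  · refine Fin.lastCases ?_ (fun j => ?_) j <;> simp [affinePoint, hx]

theorem exists_repr_affinePoint_pos [Fintype ι] (s : Basis ι ℝ (PVec p (q + 1))) :
    ∃ (ε : ℝ) (y : PVec p q), ∀ i, 0 < ε * s.repr (affinePoint y) i := by
  classical
  obtain ⟨x, hx, hpos⟩ : ∃ x : PVec p (q + 1), x (Sum.inr (Fin.last q)) ≠ 0 ∧
      ∀ i, 0 < s.repr x i := by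
    -- The sum of the basis has positive coordinates; if it lies in the hyperplane at infinity,
    -- adding one more basis vector off that hyperplane moves it away.
    by_cases h0 : (∑ i, s i) (Sum.inr (Fin.last q)) = 0
    · obtain ⟨k, hk⟩ : ∃ k, s k (Sum.inr (Fin.last q)) ≠ 0 := by
        by_contra! hcon
        have h1 := congrFun (s.sum_repr (Pi.single (Sum.inr (Fin.last q)) 1))
          (Sum.inr (Fin.last q))
        simp [Finset.sum_apply, hcon] at h1
      refine ⟨∑ i, s i + s k, by simpa [h0] using hk, fun i => ?_⟩
      simp [Finset.sum_apply, Finsupp.single_apply]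
      split_ifs <;> norm_num
    · exact ⟨_, h0, fun i => by simp [Finsupp.single_apply]⟩
  obtain ⟨y, hy⟩ := exists_affinePoint_eq hx
  exact ⟨x (Sum.inr (Fin.last q)), y, fun i => by simpa [hy, hx] using hpos i⟩

open MeasureTheory in
/-- The convex hull of a basis has infinite volume if it is preserved by a volume preserving linear
isometry which expands one of the coordinates. -/
theorem hypVolume_interior_projHull_eq_top [Fintype ι] (s : Basis ι ℝ (PVec p (q + 1)))
    (hs : ∀ i j, form (s i) (s j) ≤ 0) {i₀ i₁ : ι} (h01 : form (s i₀) (s i₁) < 0)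
    (L : PVec p q →ₗ[ℝ] PVec p q) (hL : |LinearMap.det L| = 1) (d : ι → ℝ) (hd : ∀ i, 0 < d i)
    (hd0 : d i₀ = 2)
    (hrepr : ∀ y i, s.repr (affinePoint (L y)) i = d i * s.repr (affinePoint y) i)
    (hform : ∀ y, form (affinePoint (L y)) (affinePoint (L y)) =
      form (affinePoint y) (affinePoint y)) :
    hypVolume (interior (projHull (Set.range s))) = ⊤ := by
  obtain ⟨ε, y₀, hy₀⟩ := exists_repr_affinePoint_pos s
  set τ := ε * s.repr (affinePoint y₀) i₀ with hτ
  have hτ0 : 0 < τ := hy₀ i₀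
  set M := -form (affinePoint y₀) (affinePoint y₀) + 1 with hM
  -- Dyadic slabs in the expanded coordinate. The factor 2/3 puts `y₀` in `D 0`, as 2/3 < 1 < 4/3;
  -- the bound `M` keeps the density away from 0.
  let D : ℕ → Set (PVec p q) := fun k => {y | (∀ i, 0 < ε * s.repr (affinePoint y) i) ∧
    -form (affinePoint y) (affinePoint y) < M ∧
    2 ^ k * (2 / 3 * τ) < ε * s.repr (affinePoint y) i₀ ∧
    ε * s.repr (affinePoint y) i₀ < 2 ^ (k + 1) * (2 / 3 * τ)}
  have hcont : ∀ i, Continuous fun y : PVec p q => ε * s.repr (affinePoint y) i := fun i =>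
    continuous_const.mul ((continuous_repr s i).comp continuous_affinePoint)
  have hopen : ∀ k, IsOpen (D k) := fun k => by
    refine IsOpen.and ?_ (IsOpen.and ?_ (IsOpen.and ?_ ?_))
    · simp only [Set.ofPred_forall]
      exact isOpen_iInter_of_finite fun i => isOpen_lt continuous_const (hcont i)
    · exact isOpen_lt (continuous_form_self.comp continuous_affinePoint).neg continuous_const
    · exact isOpen_lt continuous_const (hcont i₀)
    · exact isOpen_lt (hcont i₀) continuous_const
  -- `L` doubles the coordinate `i₀` and respects the other conditions, so it shifts the slabs by
  -- one.
  have hpre : ∀ k, L ⁻¹' D (k + 1) = D k := fun k => by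
    ext y
    have h2 : ∀ i, ε * (d i * s.repr (affinePoint y) i) = d i * (ε * s.repr (affinePoint y) i) :=
      fun i => by ring
    simp only [D, Set.mem_preimage, Set.mem_ofPred_eq, hrepr, hform, h2, hd0,
      mul_pos_iff_of_pos_left (hd _), pow_succ _ (k + 1), pow_succ _ k]
    refine and_congr_right fun _ => and_congr_right fun _ => and_congr ?_ ?_ <;>
      constructor <;> intro h <;> linarith
  have hdet : LinearMap.det L ≠ 0 := fun h => by simp [h] at hL
  have hvol : ∀ k, volume (D k) = volume (D 0) := fun k => by
    induction k with
    | zero => rfl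
    | succ k ih =>
      rw [← ih, ← hpre k, Measure.addHaar_preimage_linearMap _ hdet, abs_inv, hL]
      simp
  have hne : volume (D 0) ≠ 0 := by
    refine ((hopen 0).measure_pos volume ⟨y₀, hy₀, by linarith, ?_, ?_⟩).ne'
    · simp only [← hτ]; linarith
    · simp only [← hτ]; linarith
  have hdisj : Pairwise (Function.onFun Disjoint D) := by
    have hlt : ∀ i j, i < j → Disjoint (D i) (D j) := fun i j hij => by
      rw [Set.disjoint_left]
      rintro y ⟨-, -, -, h1⟩ ⟨-, -, h2, -⟩
      have h3 : (2 : ℝ) ^ (i + 1) ≤ 2 ^ j := pow_le_pow_right₀ (by norm_num) hij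
      have h4 := mul_le_mul_of_nonneg_right h3 (by positivity : 0 ≤ 2 / 3 * τ)
      linarith
    intro i j hij
    rcases hij.lt_or_gt with h | h
    · exact hlt i j h
    · exact (hlt j i h).symm
  have hunion : volume (⋃ k, D k) = ⊤ := by
    rw [measure_iUnion hdisj fun k => (hopen k).measurableSet]
    simp only [hvol]
    exact ENNReal.tsum_const_eq_top_of_ne_zero hne
  have hneg : ∀ y ∈ ⋃ k, D k, form (affinePoint y) (affinePoint y) < 0 := fun y hy => by
    obtain ⟨k, hk⟩ := Set.mem_iUnion.1 hy
    exact form_self_neg_of_repr_pos s hs h01 hk.1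
  have hsub : ⋃ k, D k ⊆ {y : PVec p q | chart y ∈ interior (projHull (Set.range s)) ∩ hyp p q} :=
    fun y hy => by
      obtain ⟨k, hk⟩ := Set.mem_iUnion.1 hy
      have : Nonempty ι := ⟨i₀⟩
      exact ⟨mk_mem_interior_projHull s _ hk.1, _, affinePoint_ne_zero y, rfl, hneg y hy⟩
  have hM0 : 0 < M := by
    have := form_self_neg_of_repr_pos s hs h01 hy₀
    linarith
  have hbound : ∀ y ∈ ⋃ k, D k, ENNReal.ofReal (Real.sqrt (M ^ (p + q + 1))⁻¹) ≤
      ENNReal.ofReal (Real.sqrt |(metricMatrix y).det|) := fun y hy => by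
    have h0 := hneg y hy
    obtain ⟨k, hk⟩ := Set.mem_iUnion.1 hy
    have hN : 0 < -form (affinePoint y) (affinePoint y) := by linarith
    rw [abs_det_metricMatrix h0]
    have := hk.2.1
    gcongr
  refine top_unique ?_
  calc (⊤ : ENNReal)
      = ENNReal.ofReal (Real.sqrt (M ^ (p + q + 1))⁻¹) * volume (⋃ k, D k) := by
        rw [hunion, ENNReal.mul_top]
        simpa using by positivity
    _ = ∫⁻ _ in ⋃ k, D k, ENNReal.ofReal (Real.sqrt (M ^ (p + q + 1))⁻¹) := by
        rw [setLIntegral_const]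
    _ ≤ ∫⁻ y in ⋃ k, D k, ENNReal.ofReal (Real.sqrt |(metricMatrix y).det|) :=
        setLIntegral_mono' (MeasurableSet.iUnion fun k => (hopen k).measurableSet) hbound
    _ ≤ _ := lintegral_mono_set hsub

end Volume

/-! ### Orthogonal sums with the Lorentzian plane -/

section Sum

variable {P R : ℕ}

/-- The isometric identification of `ℝ^{1,1} ⊕ ℝ^{P,R}` with `ℝ^{P+1,R+1}` which puts the
coordinates of `ℝ^{1,1}` first. -/
def planeSum (P R : ℕ) : (PVec 1 (0 + 1) × PVec P R) ≃ₗ[ℝ] PVec (P + 1) (R + 1) where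
  toFun u := Sum.elim (Fin.cons (α := fun _ => ℝ) (u.1 (Sum.inl 0)) fun i => u.2 (Sum.inl i))
    (Fin.cons (α := fun _ => ℝ) (u.1 (Sum.inr 0)) fun j => u.2 (Sum.inr j))
  invFun x := (Sum.elim (fun _ => x (Sum.inl 0)) (fun _ => x (Sum.inr 0)),
    Sum.elim (fun i => x (Sum.inl i.succ)) (fun j => x (Sum.inr j.succ)))
  map_add' u v := by
    ext (i | j)
    · refine Fin.cases ?_ (fun i => ?_) i <;> simp
    · refine Fin.cases ?_ (fun j => ?_) j <;> simp
  map_smul' c u := by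
    ext (i | j)
    · refine Fin.cases ?_ (fun i => ?_) i <;> simp
    · refine Fin.cases ?_ (fun j => ?_) j <;> simp
  left_inv u := by
    ext (i | j)
    · simp [Subsingleton.elim i 0]
    · simp [Fin.fin_one_eq_zero j]
    · simp
    · simp
  right_inv x := by
    ext (i | j)
    · refine Fin.cases ?_ (fun i => ?_) i <;> simp
    · refine Fin.cases ?_ (fun j => ?_) j <;> simp

theorem planeSum_apply (u : PVec 1 (0 + 1) × PVec P R) : planeSum P R u =
    Sum.elim (Fin.cons (α := fun _ => ℝ) (u.1 (Sum.inl 0)) fun i => u.2 (Sum.inl i))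
      (Fin.cons (α := fun _ => ℝ) (u.1 (Sum.inr 0)) fun j => u.2 (Sum.inr j)) := rfl

theorem form_planeSum (u v : PVec 1 (0 + 1) × PVec P R) :
    form (planeSum P R u) (planeSum P R v) = form u.1 v.1 + form u.2 v.2 := by
  simp [form, planeSum_apply, Fin.sum_univ_succ]
  ring

/-- A basis of `ℝ^{1,1}` made of isotropic vectors. -/
def planeBasis : Basis (Fin 2) ℝ (PVec 1 (0 + 1)) :=
  basisOfLinearIndependentOfCardEqFinrank
    (b := ![Sum.elim (fun _ => 1) (fun _ => 1), Sum.elim (fun _ => -1) (fun _ => 1)])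
    (by
      rw [LinearIndependent.pair_iff]
      intro a b h
      have h1 := congrFun h (Sum.inl 0)
      have h2 := congrFun h (Sum.inr 0)
      simp at h1 h2
      constructor <;> linarith)
    (by simp)

theorem planeBasis_zero : planeBasis 0 = Sum.elim (fun _ => 1) (fun _ => 1) := by
  simp [planeBasis]

theorem planeBasis_one : planeBasis 1 = Sum.elim (fun _ => -1) (fun _ => 1) := by
  simp [planeBasis]

theorem form_planeBasis (i j : Fin 2) :
    form (planeBasis i) (planeBasis j) = if i = j then 0 else -2 := by
  fin_cases i <;> fin_cases j <;> simp [planeBasis_zero, planeBasis_one, form] <;> norm_num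

theorem isIdeal_planeBasis : IsIdeal (p := 1) (q := 0) (basisLines planeBasis) :=
  (isIdeal_basisLines_iff _).2 fun i => by simp [form_planeBasis]

theorem isSimplex_planeBasis : IsSimplex (p := 1) (q := 0) (basisLines planeBasis) :=
  isSimplex_basisLines _ fun i j => by rw [form_planeBasis]; split_ifs <;> norm_num

/-- The quadratic form x² - y² of the plane splits into two linear factors, hence exactly two
isotropic lines. -/
theorem boundary_one_zero : boundary 1 0 = basisLines planeBasis := by
  refine Set.Subset.antisymm ?_ isIdeal_planeBasis
  rintro _ ⟨x, hx, rfl, h⟩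
  have h' : (x (Sum.inl 0) - x (Sum.inr 0)) * (x (Sum.inl 0) + x (Sum.inr 0)) = 0 := by
    simp [form] at h
    linarith
  rcases mul_eq_zero.1 h' with h | h
  · refine ⟨0, ((Projectivization.mk_eq_mk_iff' ℝ _ _ _ _).2 ⟨x (Sum.inr 0), ?_⟩).symm⟩
    rw [planeBasis_zero]
    ext (i | i)
    · simp [Subsingleton.elim i 0]; linarith
    · simp [Fin.fin_one_eq_zero i]
  · refine ⟨1, ((Projectivization.mk_eq_mk_iff' ℝ _ _ _ _).2 ⟨x (Sum.inr 0), ?_⟩).symm⟩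
    rw [planeBasis_one]
    ext (i | i)
    · simp [Subsingleton.elim i 0]; linarith
    · simp [Fin.fin_one_eq_zero i]

/-- An ideal simplex of `H^{1,0}` is the whole boundary. -/
theorem eq_basisLines_planeBasis {Λ : Set (ℙ ℝ (PVec 1 (0 + 1)))} (h : IsSimplex Λ)
    (hI : IsIdeal Λ) : Λ = basisLines planeBasis := by
  refine Set.eq_of_subset_of_ncard_le (boundary_one_zero ▸ hI) ?_ (Set.finite_range _)
  rw [h.2.1, isSimplex_planeBasis.2.1]

variable {ι : Type*}

/-- The basis of `ℝ^{P+1,R+1}` obtained from a basis of `ℝ^{P,R}` by adding `planeBasis`. -/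
def sumBasis (b : Basis ι ℝ (PVec P R)) : Basis (Fin 2 ⊕ ι) ℝ (PVec (P + 1) (R + 1)) :=
  (planeBasis.prod b).map (planeSum P R)

theorem sumBasis_inl (b : Basis ι ℝ (PVec P R)) (i : Fin 2) :
    sumBasis b (Sum.inl i) = planeSum P R (planeBasis i, 0) := by
  simp [sumBasis]

theorem sumBasis_inr (b : Basis ι ℝ (PVec P R)) (i : ι) :
    sumBasis b (Sum.inr i) = planeSum P R (0, b i) := by
  simp [sumBasis]

theorem form_sumBasis_nonpos (b : Basis ι ℝ (PVec P R)) (hb : ∀ i j, form (b i) (b j) ≤ 0)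
    (i j : Fin 2 ⊕ ι) : form (sumBasis b i) (sumBasis b j) ≤ 0 := by
  rcases i with i | i <;> rcases j with j | j <;>
    simp only [sumBasis_inl, sumBasis_inr, form_planeSum, form_planeBasis, form_zero_left,
      form_zero_right, add_zero, zero_add, le_refl, hb]
  split_ifs <;> norm_num

theorem form_sumBasis_inr (b : Basis ι ℝ (PVec P R)) (i : ι) :
    form (sumBasis b (Sum.inr i)) (sumBasis b (Sum.inr i)) = form (b i) (b i) := by
  simp only [sumBasis_inr, form_planeSum, form_zero_left, zero_add]

theorem form_sumBasis_inl (b : Basis ι ℝ (PVec P R)) (i : Fin 2) :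
    form (sumBasis b (Sum.inl i)) (sumBasis b (Sum.inl i)) = 0 := by
  simp [sumBasis_inl, form_planeSum, form_planeBasis, form_zero_left]

theorem mapLines_basisLines {p r p' r' : ℕ} {κ : Type*} (f : PVec p r →ₗ[ℝ] PVec p' r')
    (b : Basis κ ℝ (PVec p r)) (c : Basis ι ℝ (PVec p' r')) (g : κ → ι)
    (h : ∀ i, c (g i) = f (b i)) :
    mapLines f (basisLines b) =
      Set.range fun i => Projectivization.mk ℝ (c (g i)) (c.ne_zero (g i)) := by
  ext ξ
  have key : ∀ i, ξ.submodule = (Projectivization.mk ℝ (b i) (b.ne_zero i)).submodule.map f ↔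
      Projectivization.mk ℝ (c (g i)) (c.ne_zero (g i)) = ξ := fun i => by
    rw [← Projectivization.submodule_injective.eq_iff, Projectivization.submodule_mk,
      Projectivization.submodule_mk, Submodule.map_span, Set.image_singleton, h, eq_comm]
  simp [mapLines, basisLines, ← key]

theorem isOrthogonalSum_sumBasis (b : Basis ι ℝ (PVec P R)) :
    IsOrthogonalSum (basisLines planeBasis) (basisLines b) (basisLines (sumBasis b)) := by
  refine ⟨planeSum P R, form_planeSum, ?_⟩
  rw [mapLines_basisLines _ planeBasis (sumBasis b) Sum.inl fun i => by simp [sumBasis_inl],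
    mapLines_basisLines _ b (sumBasis b) Sum.inr fun i => by simp [sumBasis_inr]]
  ext ξ
  simp [basisLines]

/-! ### Boosts -/

/-- A Lorentz boost of the plane of the first positive and the first negative coordinates. -/
def boost (P R : ℕ) : PVec (P + 1) (R + 1) →ₗ[ℝ] PVec (P + 1) (R + 1) where
  -- 5/4 and 3/4 are the hyperbolic cosine and sine of log 2, so the eigenvalues on the isotropic
  -- lines are 2 and 1/2.
  toFun x := Sum.elim
    (Fin.cons (α := fun _ => ℝ) ((5 * x (Sum.inl 0) + 3 * x (Sum.inr 0)) / 4)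
      fun i => x (Sum.inl i.succ))
    (Fin.cons (α := fun _ => ℝ) ((3 * x (Sum.inl 0) + 5 * x (Sum.inr 0)) / 4)
      fun j => x (Sum.inr j.succ))
  map_add' x y := by
    ext (i | j)
    · refine Fin.cases ?_ (fun i => ?_) i <;> simp; ring
    · refine Fin.cases ?_ (fun j => ?_) j <;> simp; ring
  map_smul' c x := by
    ext (i | j)
    · refine Fin.cases ?_ (fun i => ?_) i <;> simp; ring
    · refine Fin.cases ?_ (fun j => ?_) j <;> simp; ring

theorem boost_apply (x : PVec (P + 1) (R + 1)) : boost P R x = Sum.elim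
    (Fin.cons (α := fun _ => ℝ) ((5 * x (Sum.inl 0) + 3 * x (Sum.inr 0)) / 4)
      fun i => x (Sum.inl i.succ))
    (Fin.cons (α := fun _ => ℝ) ((3 * x (Sum.inl 0) + 5 * x (Sum.inr 0)) / 4)
      fun j => x (Sum.inr j.succ)) := rfl

/-- The reflection changing the sign of the first positive coordinate. -/
def reflect (P R : ℕ) : PVec (P + 1) (R + 1) →ₗ[ℝ] PVec (P + 1) (R + 1) where
  toFun x := Sum.elim
    (Fin.cons (α := fun _ => ℝ) (-x (Sum.inl 0)) fun i => x (Sum.inl i.succ))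
    (fun j => x (Sum.inr j))
  map_add' x y := by
    ext (i | j)
    · refine Fin.cases ?_ (fun i => ?_) i <;> simp; ring
    · simp
  map_smul' c x := by
    ext (i | j)
    · refine Fin.cases ?_ (fun i => ?_) i <;> simp
    · simp

theorem reflect_apply (x : PVec (P + 1) (R + 1)) : reflect P R x = Sum.elim
    (Fin.cons (α := fun _ => ℝ) (-x (Sum.inl 0)) fun i => x (Sum.inl i.succ))
    (fun j => x (Sum.inr j)) := rfl

/-- The reflection conjugates the boost to its inverse, which forces the determinant to square to 1.
-/
theorem abs_det_boost : |LinearMap.det (boost P R)| = 1 := by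
  have h1 : reflect P R ∘ₗ reflect P R = LinearMap.id := by
    refine LinearMap.ext fun x => ?_
    ext (i | j)
    · refine Fin.cases ?_ (fun i => ?_) i <;> simp [reflect_apply]
    · simp [reflect_apply]
  have h2 : boost P R ∘ₗ (reflect P R ∘ₗ boost P R) ∘ₗ reflect P R = LinearMap.id := by
    refine LinearMap.ext fun x => ?_
    ext (i | j)
    · refine Fin.cases ?_ (fun i => ?_) i <;> simp [reflect_apply, boost_apply]; ring
    · refine Fin.cases ?_ (fun i => ?_) j <;> simp [reflect_apply, boost_apply]; ring
  have h3 := congrArg LinearMap.det h1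
  have h4 := congrArg LinearMap.det h2
  simp only [LinearMap.det_comp, LinearMap.det_id] at h3 h4
  have h5 : LinearMap.det (boost P R) * LinearMap.det (boost P R) = 1 := by
    linear_combination h4 - LinearMap.det (boost P R) * LinearMap.det (boost P R) * h3
  rcases mul_self_eq_one_iff.1 h5 with h | h <;> simp [h]

/-- The boost moves the first negative coordinate and the chart normalizes the last one. They differ
because there are `Q + 2` negative coordinates, so no renormalization is needed and the boost is
linear in the chart. -/
theorem affinePoint_boost {Q : ℕ} (y : PVec (P + 1) (Q + 1)) :
    affinePoint (boost P Q y) = boost P (Q + 1) (affinePoint y) := by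
  ext (i | j)
  · refine Fin.cases ?_ (fun i => ?_) i
    · have : (0 : Fin (Q + 1 + 1)) = Fin.castSucc 0 := rfl
      simp only [affinePoint, boost_apply, Sum.elim_inl, Sum.elim_inr, Fin.cons_zero, this,
        Fin.snoc_castSucc]
    · simp [affinePoint, boost_apply]
  · simp only [affinePoint, boost_apply, Sum.elim_inl, Sum.elim_inr]
    refine Fin.cases ?_ (fun i => ?_) j
    · have : (0 : Fin (Q + 1 + 1)) = Fin.castSucc 0 := rfl
      simp only [Fin.cons_zero]
      simp only [this, Fin.snoc_castSucc, Fin.cons_zero]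
    · simp only [Fin.cons_succ]
      refine Fin.lastCases ?_ (fun i => ?_) i
      · simp only [Fin.succ_last, Fin.snoc_last]
      · simp only [Fin.succ_castSucc, Fin.snoc_castSucc, Fin.cons_succ]

theorem form_boost (x : PVec (P + 1) (R + 1)) : form (boost P R x) (boost P R x) = form x x := by
  simp [form, boost_apply, Fin.sum_univ_succ]
  ring

theorem boost_sumBasis (b : Basis ι ℝ (PVec P R)) (i : Fin 2 ⊕ ι) :
    boost P R (sumBasis b i) = (Sum.elim ![2, 1 / 2] 1 i : ℝ) • sumBasis b i := by
  rcases i with i | i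
  · fin_cases i <;> ext (j | j) <;> refine Fin.cases ?_ (fun j => ?_) j <;>
      simp [sumBasis_inl, boost_apply, planeSum_apply, planeBasis_zero, planeBasis_one] <;> norm_num
  · ext (j | j) <;> refine Fin.cases ?_ (fun j => ?_) j <;>
      simp [sumBasis_inr, boost_apply, planeSum_apply]

theorem repr_map_of_eigenbasis {M : Type*} [AddCommGroup M] [Module ℝ M] (t : Basis ι ℝ M)
    (f : M →ₗ[ℝ] M) (d : ι → ℝ) (h : ∀ i, f (t i) = d i • t i) (x : M) (i : ι) :
    t.repr (f x) i = d i * t.repr x i := by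
  classical
  have : t.coord i ∘ₗ f = d i • t.coord i := t.ext fun j => by
    simp only [LinearMap.comp_apply, h, map_smul, LinearMap.smul_apply, Basis.coord_apply,
      Basis.repr_self, smul_eq_mul, Finsupp.single_apply]
    split_ifs with hij <;> simp [hij]
  exact LinearMap.congr_fun this x

/-- A lift rescales each basis vector by a unit, so it is still an eigenbasis of the boost. The
product of its two plane vectors is nonzero, hence negative by positivity of the lift. -/
theorem hypVolume_conv_sumBasis {Q : ℕ} [Fintype ι] (b : Basis ι ℝ (PVec P (Q + 1)))
    (s : basisLines (sumBasis b) → PVec (P + 1) (Q + 1 + 1))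
    (hs : IsPositiveLift (basisLines (sumBasis b)) s) : hypVolume (conv s) = ⊤ := by
  have hw : ∀ i, ∃ w : ℝˣ, w • sumBasis b i = s ⟨_, Set.mem_range_self i⟩ := fun i => by
    obtain ⟨h0, h⟩ := hs.1 ⟨_, Set.mem_range_self i⟩
    exact (Projectivization.mk_eq_mk_iff ℝ _ _ _ _).1 h
  choose w hw using hw
  have hrange : Set.range s = Set.range ((sumBasis b).unitsSMul w) := by
    ext x
    constructor
    · rintro ⟨⟨_, i, rfl⟩, rfl⟩
      exact ⟨i, by rw [Basis.unitsSMul_apply, hw]⟩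
    · rintro ⟨i, rfl⟩
      exact ⟨_, by rw [Basis.unitsSMul_apply, hw]⟩
  have hpos : ∀ i j, form ((sumBasis b).unitsSMul w i) ((sumBasis b).unitsSMul w j) ≤ 0 :=
    fun i j => by
      rw [Basis.unitsSMul_apply, Basis.unitsSMul_apply, hw, hw]
      exact hs.2.2 _ _
  rw [conv, hrange]
  refine hypVolume_interior_projHull_eq_top _ hpos (i₀ := Sum.inl 0) (i₁ := Sum.inl 1)
    ((hpos _ _).lt_of_ne ?_) (boost P Q) abs_det_boost (Sum.elim ![2, 1 / 2] 1) ?_ rfl ?_ ?_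
  · simp [Basis.unitsSMul_apply, Units.smul_def, form_smul_left, form_smul_right, sumBasis_inl,
      form_planeSum, form_planeBasis]
    simp [form]
  · rintro (i | i)
    · fin_cases i <;> simp
    · simp
  · intro y i
    rw [affinePoint_boost]
    refine repr_map_of_eigenbasis _ _ _ (fun i => ?_) _ _
    rw [Basis.unitsSMul_apply, Units.smul_def, map_smul, boost_sumBasis, smul_comm]
  · intro y
    rw [affinePoint_boost, form_boost]

end Sum

/-! ### Examples of simplices -/

section Examples

/-- A basis of `ℝ^{P,Q+1}` spanning a non-ideal simplex. -/
def nonIdealVec (P Q : ℕ) : Fin P ⊕ Fin (Q + 1) → PVec P (Q + 1) :=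
  Sum.elim (fun i => Sum.elim (Pi.single i 1) (Pi.single 0 1)) fun j => Sum.elim 0 (Pi.single j 1)

/-- With e and f the positive and negative unit vectors, the vectors e_i + f_0 and f_j have products
0 or -1, and f_0 is not isotropic. -/
theorem exists_nonIdeal_basis (P Q : ℕ) : ∃ b : Basis (Fin P ⊕ Fin (Q + 1)) ℝ (PVec P (Q + 1)),
    (∀ i j, form (b i) (b j) ≤ 0) ∧ ∃ i, form (b i) (b i) ≠ 0 := by
  have hli : LinearIndependent ℝ (nonIdealVec P Q) := by
    rw [Fintype.linearIndependent_iff]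
    intro g hg
    have h1 : ∀ i, g (Sum.inl i) = 0 := fun i => by
      simpa [nonIdealVec, Fintype.sum_sum_type, Finset.sum_apply, Pi.single_apply] using
        congrFun hg (Sum.inl i)
    rintro (i | j)
    · exact h1 i
    · simpa [nonIdealVec, Fintype.sum_sum_type, Finset.sum_apply, Pi.single_apply, h1] using
        congrFun hg (Sum.inr j)
  refine ⟨basisOfLinearIndependentOfCardEqFinrank hli (by simp), ?_, Sum.inr 0, ?_⟩
  · rintro (i | i) (j | j) <;>
      simp [nonIdealVec, form, Pi.single_apply] <;> split_ifs <;> norm_num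
  · simp [nonIdealVec, form, Pi.single_apply]

/-- Vectors of `ℝ^{K+2,Q+1}`, isotropic if `c ^ 2 + d ^ 2 = 1` and if all the points `(α j, β j)`
lie on the unit circle. -/
def idealVec {K Q : ℕ} (c d : ℝ) (α β : Fin Q → ℝ) :
    Fin (K + 2) ⊕ Fin (Q + 1) → PVec (K + 2) (Q + 1) :=
  Sum.elim (fun i => Sum.elim (Pi.single i 1) (Pi.single 0 1))
    (Fin.cons (Sum.elim (Pi.single 0 (-1)) (Pi.single 0 1))
      fun j => Sum.elim (Pi.single 0 (α j) + Pi.single 1 (β j)) (Fin.cons c (Pi.single j d)))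

/-- The vectors e_i + f_0 and -e_0 + f_0 are an isotropic basis of `ℝ^{K+2,1}`. Each further
negative direction gets a vector α_j e_0 + β_j e_1 + c f_0 + d f_{j+1}, with (α_j, β_j) on the unit
circle. Its products with the others are cosines of nonzero angles minus c or c², or just -c; all
are negative once c < 1 is close to 1. The circle uses two positive directions. -/
theorem exists_ideal_basis (K Q : ℕ) :
    ∃ b : Basis (Fin (K + 2) ⊕ Fin (Q + 1)) ℝ (PVec (K + 2) (Q + 1)),
      (∀ i j, form (b i) (b j) ≤ 0) ∧ ∀ i, form (b i) (b i) = 0 := by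
  obtain ⟨α, β, h1, h2, h3, h4⟩ : ∃ α β : Fin Q → ℝ, (∀ j, α j ^ 2 + β j ^ 2 = 1) ∧
      (∀ j, |α j| < 1) ∧ (∀ j, β j < 1) ∧ ∀ j k, j ≠ k → α j * α k + β j * β k < 1 := by
    -- Rational parametrization of the circle at t = j + 2: distinct points, and t ≥ 2 avoids (1, 0)
    -- at t = 0 and (0, 1) at t = 1.
    refine ⟨fun j => (1 - (j + 2 : ℝ) ^ 2) / (1 + (j + 2 : ℝ) ^ 2),
      fun j => 2 * (j + 2 : ℝ) / (1 + (j + 2 : ℝ) ^ 2), fun j => ?_, fun j => ?_, fun j => ?_,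
      fun j k hjk => ?_⟩
    · field_simp
      ring
    · rw [abs_lt, lt_div_iff₀ (by positivity), div_lt_one (by positivity)]
      constructor <;> nlinarith [(Nat.cast_nonneg (j : ℕ) : (0 : ℝ) ≤ (j : ℕ))]
    · rw [div_lt_one (by positivity)]
      nlinarith [(Nat.cast_nonneg (j : ℕ) : (0 : ℝ) ≤ (j : ℕ))]
    · have hne : ((j : ℕ) : ℝ) - (k : ℕ) ≠ 0 :=
        sub_ne_zero.2 fun h => hjk (Fin.ext (by exact_mod_cast h))
      rw [div_mul_div_comm, div_mul_div_comm, ← add_div, div_lt_one (by positivity)]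
      nlinarith [sq_pos_of_ne_zero hne]
  -- Finitely many strict inequalities that hold at c = 1 persist for c slightly below 1; keeping c
  -- < 1 makes d nonzero, which independence needs.
  obtain ⟨c, hc0, hc1, g2, g3, g4⟩ : ∃ c : ℝ, 0 < c ∧ c < 1 ∧ (∀ j, |α j| < c) ∧
      (∀ j, β j < c) ∧ ∀ j k, j ≠ k → α j * α k + β j * β k < c * c := by
    have hid : Filter.Tendsto (fun c : ℝ => c) (nhdsWithin 1 (Set.Iio 1)) (nhds 1) :=
      nhdsWithin_le_nhds
    have hsq : Filter.Tendsto (fun c : ℝ => c * c) (nhdsWithin 1 (Set.Iio 1)) (nhds 1) := by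
      simpa using hid.mul hid
    have hlt : ∀ᶠ c : ℝ in nhdsWithin 1 (Set.Iio 1), c < 1 := self_mem_nhdsWithin
    exact ((hid.eventually_const_lt one_pos).and (hlt.and
      ((Filter.eventually_all.2 fun j => hid.eventually_const_lt (h2 j)).and
      ((Filter.eventually_all.2 fun j => hid.eventually_const_lt (h3 j)).and
      (Filter.eventually_all.2 fun j => Filter.eventually_all.2 fun k =>
        Filter.eventually_imp_distrib_left.2 fun hjk =>
          hsq.eventually_const_lt (h4 j k hjk)))))).exists
  have hd0 : 0 < 1 - c ^ 2 := by nlinarith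
  set d := Real.sqrt (1 - c ^ 2)
  have hd : d * d = 1 - c ^ 2 := Real.mul_self_sqrt hd0.le
  have hdne : d ≠ 0 := (Real.sqrt_pos.2 hd0).ne'
  have hli : LinearIndependent ℝ (idealVec (K := K) c d α β) := by
    rw [Fintype.linearIndependent_iff]
    intro g hg
    have e1 : ∀ j, g (Sum.inr (Fin.succ j)) = 0 := fun j => by
      simpa [idealVec, Fintype.sum_sum_type, Finset.sum_apply, Pi.single_apply, Fin.sum_univ_succ,
        hdne] using congrFun hg (Sum.inr (Fin.succ j))
    have e2 : ∀ i, g (Sum.inl i) = if i = 0 then g (Sum.inr 0) else 0 := fun i => by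
      have := congrFun hg (Sum.inl i)
      simp [idealVec, Fintype.sum_sum_type, Finset.sum_apply, Pi.single_apply,
        Fin.sum_univ_succ (n := Q), e1] at this
      split_ifs with h <;> simp [h] at this ⊢ <;> linarith
    have e3 : g (Sum.inr 0) = 0 := by
      have := congrFun hg (Sum.inr 0)
      simp [idealVec, Fintype.sum_sum_type, Finset.sum_apply, Fin.sum_univ_succ (n := Q),
        e1, e2] at this
      linarith
    rintro (i | j)
    · simp [e2, e3]
    · refine Fin.cases e3 e1 j
  set v := idealVec (K := K) c d α β with hv
  have f1 : ∀ i j, form (v (Sum.inl i)) (v (Sum.inl j)) = if i = j then 0 else -1 := fun i j => by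
    simp [hv, idealVec, form, Pi.single_apply, eq_comm (a := j)]
    split_ifs <;> simp
  have f2 : ∀ i, form (v (Sum.inl i)) (v (Sum.inr 0)) ≤ 0 := fun i => by
    simp [hv, idealVec, form, Pi.single_apply]
    split_ifs <;> norm_num
  have f3 : ∀ i j, form (v (Sum.inl i)) (v (Sum.inr (Fin.succ j))) ≤ 0 := fun i j => by
    have hα := abs_lt.1 (g2 j)
    have hβ := g3 j
    simp [hv, idealVec, form, Pi.single_apply]
    split_ifs with h h' <;> first | linarith | simp_all
  have f4 : form (v (Sum.inr 0)) (v (Sum.inr 0)) = 0 := by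
    simp [hv, idealVec, form, Pi.single_apply]
  have f5 : ∀ j, form (v (Sum.inr 0)) (v (Sum.inr (Fin.succ j))) ≤ 0 := fun j => by
    have hα := abs_lt.1 (g2 j)
    simp [hv, idealVec, form, Pi.single_apply]
    linarith
  have f6 : ∀ j k, form (v (Sum.inr (Fin.succ j))) (v (Sum.inr (Fin.succ k))) =
      α j * α k + β j * β k - c * c - if j = k then d * d else 0 := fun j k => by
    simp [hv, idealVec, form, Pi.single_apply, Fin.sum_univ_succ, Fin.succ_succ_ne_one,
      eq_comm (a := k)]
    ring
  have f7 : ∀ j, form (v (Sum.inr (Fin.succ j))) (v (Sum.inr (Fin.succ j))) = 0 := fun j => by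
    rw [f6, if_pos rfl, hd]
    linarith [h1 j]
  refine ⟨basisOfLinearIndependentOfCardEqFinrank hli (by simp), ?_, ?_⟩ <;>
    simp only [coe_basisOfLinearIndependentOfCardEqFinrank]
  · have f8 : ∀ i j, form (v (Sum.inl i)) (v (Sum.inr j)) ≤ 0 := fun i j =>
      Fin.cases (f2 i) (f3 i) j
    rintro (i | j) (k | l)
    · rw [f1]
      split_ifs <;> norm_num
    · exact f8 i l
    · rw [form_comm]
      exact f8 k j
    · induction j using Fin.cases with
      | zero => exact Fin.cases f4.le f5 l
      | succ j =>
        induction l using Fin.cases with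
        | zero => rw [form_comm]; exact f5 j
        | succ l =>
          by_cases hjl : j = l
          · rw [hjl, f7]
          · rw [f6, if_neg hjl]
            linarith [g4 j l hjl]
  · rintro (i | j)
    · rw [f1, if_pos rfl]
    · exact Fin.cases f4 f7 j

end Examples

end

end PseudoHyperbolic

theorem mainTheorem3 (p q : ℕ) (hp : 1 ≤ p) (hq : 1 ≤ q) :
    ∃ Λ₀ : Set (ℙ ℝ (PseudoHyperbolic.PVec 1 (0 + 1))),
      (PseudoHyperbolic.IsSimplex Λ₀ ∧ PseudoHyperbolic.IsIdeal Λ₀ ∧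
        ∀ Λ₀' : Set (ℙ ℝ (PseudoHyperbolic.PVec 1 (0 + 1))),
          PseudoHyperbolic.IsSimplex Λ₀' → PseudoHyperbolic.IsIdeal Λ₀' → Λ₀' = Λ₀) ∧
      (∃ (Λ₁ : Set (ℙ ℝ (PseudoHyperbolic.PVec (p - 1) ((q - 1) + 1))))
          (Λ : Set (ℙ ℝ (PseudoHyperbolic.PVec p (q + 1)))),
        PseudoHyperbolic.IsSimplex Λ₁ ∧ PseudoHyperbolic.IsOrthogonalSum Λ₀ Λ₁ Λ ∧
          PseudoHyperbolic.IsSimplex Λ ∧ ¬ PseudoHyperbolic.IsIdeal Λ ∧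
          PseudoHyperbolic.HasVolume Λ ⊤) ∧
      (3 ≤ p → ∃ (Λ₁ : Set (ℙ ℝ (PseudoHyperbolic.PVec (p - 1) ((q - 1) + 1))))
          (Λ : Set (ℙ ℝ (PseudoHyperbolic.PVec p (q + 1)))),
        PseudoHyperbolic.IsSimplex Λ₁ ∧ PseudoHyperbolic.IsIdeal Λ₁ ∧
          PseudoHyperbolic.IsOrthogonalSum Λ₀ Λ₁ Λ ∧
          PseudoHyperbolic.IsSimplex Λ ∧ PseudoHyperbolic.IsIdeal Λ ∧
          PseudoHyperbolic.HasVolume Λ ⊤) := by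
  open PseudoHyperbolic in
  obtain ⟨P, rfl⟩ : ∃ P, p = P + 1 := ⟨p - 1, by omega⟩
  obtain ⟨Q, rfl⟩ : ∃ Q, q = Q + 1 := ⟨q - 1, by omega⟩
  refine ⟨basisLines planeBasis, ⟨isSimplex_planeBasis, isIdeal_planeBasis,
    fun _ => eq_basisLines_planeBasis⟩, ?_, fun h3 => ?_⟩
  · obtain ⟨b, hb, i, hi⟩ := exists_nonIdeal_basis P Q
    have hs := form_sumBasis_nonpos b hb
    refine ⟨basisLines b, basisLines (sumBasis b), isSimplex_basisLines b hb,
      isOrthogonalSum_sumBasis b, isSimplex_basisLines _ hs, fun h => hi ?_,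
      (exists_isPositiveLift_basisLines _ hs).imp fun _ h => h.1, hypVolume_conv_sumBasis b⟩
    rw [← form_sumBasis_inr]
    exact (isIdeal_basisLines_iff _).1 h _
  -- Once the plane has used one positive direction, p ≥ 3 leaves the two that the circle requires.
  · obtain ⟨K, rfl⟩ : ∃ K, P = K + 2 := ⟨P - 2, by omega⟩
    obtain ⟨b, hb, hi⟩ := exists_ideal_basis K Q
    have hs := form_sumBasis_nonpos b hb
    refine ⟨basisLines b, basisLines (sumBasis b), isSimplex_basisLines b hb,
      (isIdeal_basisLines_iff b).2 hi, isOrthogonalSum_sumBasis b, isSimplex_basisLines _ hs,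
      (isIdeal_basisLines_iff _).2 ?_,
      (exists_isPositiveLift_basisLines _ hs).imp fun _ h => h.1, hypVolume_conv_sumBasis b⟩
    rintro (i | i)
    · exact form_sumBasis_inl b i
    · rw [form_sumBasis_inr, hi]
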